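/- Let $\|\cdot\|$ be a strictly convex norm on $\mathbb R^2$ (i.e. $v\mapsto\|v\|^2$ is strictly convex) which is $C^{1,1}$ on $\mathbb R^2\setminus\{0\}$ (i.e. differentiable there with locally Lipschitz differential). Let $\Omega$ be its closed unit ball, $\Omega^\circ=\{p\in\mathbb R^2:\langle p,v\rangle\le 1\ \forall v\in\Omega\}$ the polar set, and $\mathbb S^\circ$ the area of $\Omega^\circ$. For $\theta\in[0,2\mathbb S^\circ)$ let $(\cos_{\Omega^\circ}\theta,\sin_{\Omega^\circ}\theta)$ be the point $Q$ of $\partial\Omega^\circ$ such that the sector of $\Omega^\circ$ swept counterclockwise from the positive $x$-axis to the ray $OQ$ has area $\theta/2$; extend $\cos_{\Omega^\circ},\sin_{\Omega^\circ}$ to $\mathbb R$ with period $2\mathbb S^\circ$. In the Heisenberg group $\mathbb R^3$ with the left-invariant sub-Finsler structure induced by $\|\cdot\|$, the exponential map at the origin is, for $\phi\in\mathbb R$, $\omega\ne0$, $r\geq 0$, $t\in\mathbb R$, the map $(\phi,\omega,r;t)\mapsto(x,y,z)$ with \begin{align*} x&=\tfrac r\omega\big(\sin_{\Omega^\circ}(\phi+\omega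 t)-\sin_{\Omega^\circ}(\phi)\big),\qquad y=-\tfrac r\omega\big(\cos_{\Omega^\circ}(\phi+\omega t)-\cos_{\Omega^\circ}(\phi)\big),\\ z&=\tfrac{r^2}{2\omega^2}\big(\omega t+\cos_{\Omega^\circ}(\phi+\omega t)\sin_{\Omega^\circ}(\phi)-\sin_{\Omega^\circ}(\phi+\omega t)\cos_{\Omega^\circ}(\phi)\big) \end{align*} (for $\omega=0$ the curves $t\mapsto (x,y,z)$ are straight lines in the plane $z=0$). Let $$J(\phi,\omega,r;t)=\left|\det\frac{\partial(x,y,z)}{\partial(r,\phi,\omega)}(\phi,\omega,r;t)\right|.$$ Then there are constants $K>0$ and $\varepsilon_0>0$ such that for every $\varepsilon\in(0,\varepsilon_0)$, for $\mathscr L^1$-almost every $\phi\in[0,2\mathbb S^\circ)$, every $r>0$ and every $\omega\neq0$, there exist constants $C>0$ and $\rho>0$ (depending on $\phi,\omega,r$ and $\varepsilon$) such that for every $t\in[-\rho,\rho]$ the map $(\phi,\omega,r)\mapsto(x,y,z)(\phi,\omega,r;t)$ is differentiable at $(\phi,\omega,r)$ and $$C(1-K\varepsilon)|t|^5\le J(\phi,\omega,r;t)\le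 C(1+K\varepsilon)|t|^5,$$ with both inequalities strict if $t\neq0$. -/

import Mathlib

open MeasureTheory Set

noncomputable section

namespace SubFinslerHeisenberg

/-! ### Norms on the plane

A norm on `ℝ²` is a `Seminorm ℝ (ℝ × ℝ)` which vanishes only at the origin. -/

/-- `N` is a strictly convex norm: the function `v ↦ N(v)²` is strictly convex. -/
def IsStrictlyConvexNorm (N : Seminorm ℝ (ℝ × ℝ)) : Prop :=
  StrictConvexOn ℝ univ (fun v : ℝ × ℝ => N v ^ 2)

/-- `N` is of class `C^{1,1}` on `ℝ² ∖ {0}`: it is differentiable there, with locally Lipschitz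
differential. -/
def IsC11Norm (N : Seminorm ℝ (ℝ × ℝ)) : Prop :=
  DifferentiableOn ℝ (fun v : ℝ × ℝ => N v) {0}ᶜ ∧
    LocallyLipschitzOn {0}ᶜ (fderiv ℝ (fun v : ℝ × ℝ => N v))

/-- The closed unit ball of `N`. -/
def unitBall (N : Seminorm ℝ (ℝ × ℝ)) : Set (ℝ × ℝ) := {v | N v ≤ 1}

/-! ### Convex trigonometry

Here `Ω ⊆ ℝ²` is a compact convex set with the origin in its interior. -/

/-- The Euclidean scalar product of `ℝ²`. -/
def dot (v w : ℝ × ℝ) : ℝ := v.1 * w.1 + v.2 * w.2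

/-- The polar set `Ω°`. -/
def polarSet (Ω : Set (ℝ × ℝ)) : Set (ℝ × ℝ) := {p | ∀ v ∈ Ω, dot p v ≤ 1}

/-- The area `𝕊` of `Ω`. -/
def area (Ω : Set (ℝ × ℝ)) : ℝ := volume.real Ω

/-- The area of the sector of `Ω` swept counterclockwise from the positive `x`-axis to the ray
from the origin of Euclidean angle `α ∈ [0, 2π)`. -/
def sectorArea (Ω : Set (ℝ × ℝ)) (α : ℝ) : ℝ :=
  volume.real {p ∈ Ω | ∃ s : ℝ, 0 ≤ s ∧ ∃ β ∈ Icc 0 α, p = (s * Real.cos β, s * Real.sin β)}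

/-- The point where the ray of Euclidean angle `α` meets the boundary of `Ω`. -/
def boundaryPoint (Ω : Set (ℝ × ℝ)) (α : ℝ) : ℝ × ℝ :=
  (gauge Ω (Real.cos α, Real.sin α))⁻¹ • (Real.cos α, Real.sin α)

/-- The representative in `[0, 2𝕊)` of the generalized angle `θ` modulo `2𝕊`. -/
def reduceAngle (Ω : Set (ℝ × ℝ)) (θ : ℝ) : ℝ :=
  2 * area Ω * Int.fract (θ / (2 * area Ω))

/-- The Euclidean angle `α ∈ [0, 2π)` for which the sector between the positive `x`-axis and the
ray of angle `α` has area `θ / 2` (with `θ` first reduced modulo `2𝕊`). -/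
def euclideanAngle (Ω : Set (ℝ × ℝ)) (θ : ℝ) : ℝ :=
  Function.invFunOn (sectorArea Ω) (Ico 0 (2 * Real.pi)) (reduceAngle Ω θ / 2)

/-- The point `P_θ = (cos_Ω θ, sin_Ω θ)` of the boundary of `Ω` with generalized angle `θ`. -/
def trigPoint (Ω : Set (ℝ × ℝ)) (θ : ℝ) : ℝ × ℝ := boundaryPoint Ω (euclideanAngle Ω θ)

/-- The convex cosine `cos_Ω`. -/
def cosΩ (Ω : Set (ℝ × ℝ)) (θ : ℝ) : ℝ := (trigPoint Ω θ).1

/-- The convex sine `sin_Ω`. -/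
def sinΩ (Ω : Set (ℝ × ℝ)) (θ : ℝ) : ℝ := (trigPoint Ω θ).2

/-- The angle `θ` (for `Ω`) and the angle `ψ` (for `Ω°`) correspond to each other: the half-plane
with outer normal `Q_ψ = (cos_{Ω°} ψ, sin_{Ω°} ψ)` and `P_θ` on its boundary contains `Ω`. -/
def Corresponds (Ω : Set (ℝ × ℝ)) (θ ψ : ℝ) : Prop :=
  ∀ v ∈ Ω, dot (trigPoint (polarSet Ω) ψ) v ≤ dot (trigPoint (polarSet Ω) ψ) (trigPoint Ω θ)

/-- The angle `ψ_∘ = C_∘(ψ)` corresponding to `ψ`, as its representative in `[0, 2𝕊)`; it is unique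
if `Ω` is strictly convex. It is used only as an argument of the `2𝕊`-periodic functions
`cos_Ω` and `sin_Ω`. -/
def lowerAngle (Ω : Set (ℝ × ℝ)) (ψ : ℝ) : ℝ :=
  sInf {θ ∈ Ico 0 (2 * area Ω) | Corresponds Ω θ ψ}

/-! ### The exponential map at the identity of the sub-Finsler Heisenberg group

The underlying manifold is `ℝ³`, `Ω` is the unit ball of the norm, and `(φ, ω, r)` are the
coordinates of the initial covector: `r (cos_{Ω°} φ, sin_{Ω°} φ)` is its horizontal part and `ω`
its vertical part. -/

/-- The component `x(φ, ω, r; t)` of the exponential map. -/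
def expX (N : Seminorm ℝ (ℝ × ℝ)) (φ ω r t : ℝ) : ℝ :=
  let Ω := unitBall N
  let Ωp := polarSet Ω
  if ω = 0 then r * cosΩ Ω (lowerAngle Ω φ) * t
  else r / ω * (sinΩ Ωp (φ + ω * t) - sinΩ Ωp φ)

/-- The component `y(φ, ω, r; t)` of the exponential map. -/
def expY (N : Seminorm ℝ (ℝ × ℝ)) (φ ω r t : ℝ) : ℝ :=
  let Ω := unitBall N
  let Ωp := polarSet Ω
  if ω = 0 then r * sinΩ Ω (lowerAngle Ω φ) * t
  else -(r / ω) * (cosΩ Ωp (φ + ω * t) - cosΩ Ωp φ)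

/-- The component `z(φ, ω, r; t)` of the exponential map. -/
def expZ (N : Seminorm ℝ (ℝ × ℝ)) (φ ω r t : ℝ) : ℝ :=
  let Ωp := polarSet (unitBall N)
  if ω = 0 then 0
  else r ^ 2 / (2 * ω ^ 2) *
    (ω * t + cosΩ Ωp (φ + ω * t) * sinΩ Ωp φ - sinΩ Ωp (φ + ω * t) * cosΩ Ωp φ)

/-- The exponential map `G(φ, ω, r; t)`. -/
def expMap (N : Seminorm ℝ (ℝ × ℝ)) (φ ω r t : ℝ) : ℝ × ℝ × ℝ :=
  (expX N φ ω r t, expY N φ ω r t, expZ N φ ω r t)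

/-- The Jacobian `J(φ, ω, r; t)`: the absolute value of the determinant of the matrix of partial
derivatives of `(x, y, z)` with respect to `(r, φ, ω)`. -/
def jacobian (N : Seminorm ℝ (ℝ × ℝ)) (φ ω r t : ℝ) : ℝ :=
  |Matrix.det
    !![deriv (fun s => expX N φ ω s t) r, deriv (fun s => expX N s ω r t) φ,
        deriv (fun s => expX N φ s r t) ω;
      deriv (fun s => expY N φ ω s t) r, deriv (fun s => expY N s ω r t) φ,
        deriv (fun s => expY N φ s r t) ω;
      deriv (fun s => expZ N φ ω s t) r, deriv (fun s => expZ N s ω r t) φ,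
        deriv (fun s => expZ N φ s r t) ω]|

end SubFinslerHeisenberg

end

/-!
The exponential map is governed by the curve `P θ = (cos θ, sin θ)` of `∂Ω°`, with velocity
`V = P'`. Write `[u, v]` for the determinant of two plane vectors. The normalization of the angle by
area says `[P, V] = 1`, and expanding the determinant gives, with `a = φ` and `b = φ + τ`,
`τ = ω t`,

`J = r³ |t| / ω⁴ * |(1 - [P a, V b]) (1 - [P b, V a]) - (τ - [P a, P b]) [V a, V b]|`

(`jacobian_eq`). Only first derivatives of `P` enter. Since `φ` is in the interior of the period for
almost every `φ`, so is `φ + ω t` for small `t`, and the periodic extension plays no role.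

If moreover `V` is differentiable at `a`, then `[P, V] = 1` forces `V' a = -k P a` for a number `k`.
In the basis `P a`, `V a` the point `P (a + τ)` has coordinates `p = 1 - k τ² / 2 + o(τ²)` and
`q = τ - k τ³ / 6 + o(τ³)`, and the last factor of `J` is `k² τ⁴ / 12 + o(τ⁴)`
(`HasAffineCurvature.tendsto_reducedJacobian`). Thus `J / |t|⁵` tends to `C = r³ k² / 12`, and if
`k ≠ 0` the estimate holds with `K = 1` and `ε₀ = 1`, for `t` small depending on `ε`.

It remains to show that for almost every `φ` the velocity is differentiable with `k ≠ 0`. In terms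
of the Euclidean angle `α`, the curve `P` is `u / h`, where `u` is the unit vector of angle `α` and
`h` the support function of `Ω`. Strict convexity of the norm makes the point `Q` of `Ω` maximizing
`⟨u, ·⟩` unique, hence continuous in `α`, hence `h` is `C¹`; and `V` is `Q` turned by a right
angle. As `Q` runs monotonically along `∂Ω`, `h' + M α` is monotone for a suitable constant `M`, so
by Lebesgue's theorem `V` is differentiable almost everywhere (`ae_differentiableAt_velocity`).
Finally, `P` is the differential of the norm at `Q`, so the `C^{1,1}` hypothesis bounds the
increments of `P` by those of `V` (`exists_norm_trigPoint_sub_le`); if `k` were zero, `V` would have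
zero derivative at `φ`, and so would `P`, against `[P, V] = 1`.
-/

namespace SubFinslerHeisenberg

open Filter Topology

/-! ### Asymptotics of the reduced Jacobian -/

/-- The determinant `[u, v]` of two plane vectors. -/
def cross (u v : ℝ × ℝ) : ℝ := u.1 * v.2 - u.2 * v.1

/-- The factor of the Jacobian which depends on the two endpoints only. Here `P` is a curve in the
plane, `V` its velocity, and `a`, `a + τ` are the parameters of the endpoints. -/
def reducedJacobian (P V : ℝ → ℝ × ℝ) (a τ : ℝ) : ℝ :=
  (1 - cross (P a) (V (a + τ))) * (1 - cross (P (a + τ)) (V a)) -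
    (τ - cross (P a) (P (a + τ))) * cross (V a) (V (a + τ))

lemma hasDerivAt_cross_left {P : ℝ → ℝ × ℝ} {v : ℝ × ℝ} {θ : ℝ} (w : ℝ × ℝ)
    (h : HasDerivAt P v θ) : HasDerivAt (fun x => cross w (P x)) (cross w v) θ := by
  have h1 : HasDerivAt (fun x => (P x).1) v.1 θ := h.fst
  have h2 : HasDerivAt (fun x => (P x).2) v.2 θ := h.snd
  exact (h2.const_mul w.1).sub (h1.const_mul w.2)

lemma cross_swap (u v : ℝ × ℝ) : cross u v = -cross v u := by
  simp only [cross]; ring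

/-- The curve `P`, its velocity `V`, and the parameter value `a` satisfy the assumptions under
which the reduced Jacobian can be expanded: near `a` the curve sweeps area at rate `1/2`, and it
has the second derivative `-k P a` at `a`. -/
structure HasAffineCurvature (P V : ℝ → ℝ × ℝ) (a k : ℝ) : Prop where
  hasDerivAt : ∀ᶠ θ in 𝓝 a, HasDerivAt P (V θ) θ
  cross_eq_one : ∀ᶠ θ in 𝓝 a, cross (P θ) (V θ) = 1
  hasDerivAt_velocity : HasDerivAt V (-k • P a) a

/-- The fourth order expansion of the reduced Jacobian. In the basis `P a`, `V a` the curve has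
coordinates `p = 1 - k τ² / 2 + o(τ²)` and `q = τ - k τ³ / 6 + o(τ³)`; the second expansion is one
order better than what the second derivative gives, thanks to the identity `p q' - q p' = 1`. -/
theorem HasAffineCurvature.tendsto_reducedJacobian {P V : ℝ → ℝ × ℝ} {a k : ℝ}
    (H : HasAffineCurvature P V a k) :
    Tendsto (fun τ => reducedJacobian P V a τ / τ ^ 4) (𝓝[≠] 0) (𝓝 (k ^ 2 / 12)) := by
  set p : ℝ → ℝ := fun τ => cross (P (a + τ)) (V a) with hp
  set q : ℝ → ℝ := fun τ => cross (P a) (P (a + τ)) with hq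
  set p1 : ℝ → ℝ := fun τ => cross (V (a + τ)) (V a) with hp1
  set q1 : ℝ → ℝ := fun τ => cross (P a) (V (a + τ)) with hq1
  have hshift : Tendsto (fun τ : ℝ => a + τ) (𝓝 0) (𝓝 a) := by
    simpa using (continuous_const_add a).tendsto 0
  have hd : ∀ᶠ τ in 𝓝 (0 : ℝ), HasDerivAt (fun τ => P (a + τ)) (V (a + τ)) τ := by
    filter_upwards [hshift.eventually H.hasDerivAt] with τ hτ
    exact hτ.comp_const_add a τ
  have hdp : ∀ᶠ τ in 𝓝 (0 : ℝ), HasDerivAt p (p1 τ) τ := by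
    filter_upwards [hd] with τ hτ
    have := (hasDerivAt_cross_left (V a) hτ).neg
    simp only [hp, hp1]
    rw [cross_swap (V (a + τ))]
    refine this.congr_of_eventuallyEq (Eventually.of_forall fun x => ?_)
    simp only [Pi.neg_apply]
    rw [cross_swap]
  have hdq : ∀ᶠ τ in 𝓝 (0 : ℝ), HasDerivAt q (q1 τ) τ := by
    filter_upwards [hd] with τ hτ
    exact hasDerivAt_cross_left (P a) hτ
  have hone : cross (P a) (V a) = 1 := H.cross_eq_one.self_of_nhds
  have hp0 : p 0 = 1 := by simp [hp, hone]
  have hq0 : q 0 = 0 := by simp only [hq, cross, add_zero]; ring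
  have hp10 : p1 0 = 0 := by simp only [hp1, cross, add_zero]; ring
  have hq10 : q1 0 = 1 := by simp [hq1, hone]
  have hdet : ∀ᶠ τ in 𝓝 (0 : ℝ), p τ * q1 τ - q τ * p1 τ = 1 := by
    filter_upwards [hshift.eventually H.cross_eq_one] with τ hτ
    have : p τ * q1 τ - q τ * p1 τ = cross (P a) (V a) * cross (P (a + τ)) (V (a + τ)) := by
      simp only [hp, hq, hp1, hq1, cross]; ring
    rw [this, hone, hτ, one_mul]
  -- the four ratio limits
  have Lp1 : Tendsto (fun τ => p1 τ / τ) (𝓝[≠] 0) (𝓝 (-k)) := by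
    have h0 : HasDerivAt (fun τ => V (a + τ)) (-k • P a) 0 :=
      HasDerivAt.comp_const_add a 0 (by simpa using H.hasDerivAt_velocity)
    have h1 : HasDerivAt p1 (-k) 0 := by
      have := (hasDerivAt_cross_left (V a) h0).neg
      have e : -cross (V a) (-k • P a) = -k := by
        have : -cross (V a) (-k • P a) = -k * cross (P a) (V a) := by
          simp only [cross, Prod.smul_fst, Prod.smul_snd, smul_eq_mul]; ring
        rw [this, hone, mul_one]
      rw [e] at this
      refine this.congr_of_eventuallyEq (Eventually.of_forall fun x => ?_)
      simp only [Pi.neg_apply, hp1]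
      rw [cross_swap]
    refine (hasDerivAt_iff_tendsto_slope_zero.1 h1).congr fun τ => ?_
    simp [hp10, div_eq_inv_mul]
  have Lq : Tendsto (fun τ => q τ / τ) (𝓝[≠] 0) (𝓝 1) := by
    have h1 : HasDerivAt q 1 0 := hq10 ▸ hdq.self_of_nhds
    refine (hasDerivAt_iff_tendsto_slope_zero.1 h1).congr fun τ => ?_
    simp [hq0, div_eq_inv_mul]
  have Cp : Tendsto p (𝓝[≠] 0) (𝓝 1) := by
    simpa only [hp0] using hdp.self_of_nhds.continuousAt.tendsto.mono_left nhdsWithin_le_nhds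
  have Cq : Tendsto q (𝓝[≠] 0) (𝓝 0) := by
    simpa only [hq0] using hdq.self_of_nhds.continuousAt.tendsto.mono_left nhdsWithin_le_nhds
  have Cid : Tendsto (fun τ : ℝ => τ) (𝓝[≠] 0) (𝓝 0) := nhdsWithin_le_nhds
  have hne : ∀ᶠ τ in 𝓝[≠] (0 : ℝ), τ ≠ 0 := self_mem_nhdsWithin
  have Lp : Tendsto (fun τ => (1 - p τ) / τ ^ 2) (𝓝[≠] 0) (𝓝 (k / 2)) := by
    refine HasDerivAt.lhopital_zero_nhdsNE (f' := fun τ => -p1 τ) (g' := fun τ => 2 * τ)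
      ?_ ?_ ?_ ?_ ?_ ?_
    · filter_upwards [hdp.filter_mono nhdsWithin_le_nhds] with τ hτ
      exact hτ.const_sub 1
    · exact Eventually.of_forall fun τ => by simpa using hasDerivAt_pow 2 τ
    · filter_upwards [hne] with τ hτ
      exact mul_ne_zero two_ne_zero hτ
    · simpa using Cp.const_sub 1
    · simpa using Cid.pow 2
    · have := Lp1.neg.div_const 2
      rw [neg_neg] at this
      refine this.congr' ?_
      filter_upwards [hne] with τ hτ
      field_simp
  have Lq1 : Tendsto (fun τ => (1 - q1 τ) / τ ^ 2) (𝓝[≠] 0) (𝓝 (k / 2)) := by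
    have := (Lp.neg.sub (Lq.mul Lp1)).div Cp one_ne_zero
    have e : (-(k / 2) - 1 * -k) / 1 = k / 2 := by ring
    rw [e] at this
    refine this.congr' ?_
    filter_upwards [hne, Cp.eventually_ne one_ne_zero, hdet.filter_mono nhdsWithin_le_nhds]
      with τ hτ hpτ hdτ
    simp only [Pi.div_apply]
    field_simp
    linarith
  have Lq3 : Tendsto (fun τ => (τ - q τ) / τ ^ 3) (𝓝[≠] 0) (𝓝 (k / 6)) := by
    refine HasDerivAt.lhopital_zero_nhdsNE (f' := fun τ => 1 - q1 τ) (g' := fun τ => 3 * τ ^ 2)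
      ?_ ?_ ?_ ?_ ?_ ?_
    · filter_upwards [hdq.filter_mono nhdsWithin_le_nhds] with τ hτ
      exact (hasDerivAt_id τ).sub hτ
    · exact Eventually.of_forall fun τ => by simpa using hasDerivAt_pow 3 τ
    · filter_upwards [hne] with τ hτ
      exact mul_ne_zero three_ne_zero (pow_ne_zero 2 hτ)
    · simpa using Cid.sub Cq
    · simpa using Cid.pow 3
    · have := Lq1.div_const 3
      have e : k / 2 / 3 = k / 6 := by ring
      rw [e] at this
      refine this.congr' ?_
      filter_upwards [hne] with τ hτ
      field_simp
  have := (Lq1.mul Lp).add (Lq3.mul Lp1)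
  have e : k / 2 * (k / 2) + k / 6 * -k = k ^ 2 / 12 := by ring
  rw [e] at this
  refine this.congr' ?_
  filter_upwards [hne] with τ hτ
  simp only [reducedJacobian]
  rw [cross_swap (V a) (V (a + τ))]
  change _ = ((1 - q1 τ) * (1 - p τ) - (τ - q τ) * -p1 τ) / τ ^ 4
  field_simp
  ring

/-! ### The Jacobian of the exponential map -/

/-- The Jacobian in terms of the curve `θ ↦ (cos θ, sin θ)` of `Ω°` and its velocity `V`. -/
theorem jacobian_eq (N : Seminorm ℝ (ℝ × ℝ)) {V : ℝ → ℝ × ℝ} {φ ω r t : ℝ} (hω : ω ≠ 0)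
    (hφ : HasDerivAt (trigPoint (polarSet (unitBall N))) (V φ) φ)
    (ht : HasDerivAt (trigPoint (polarSet (unitBall N))) (V (φ + ω * t)) (φ + ω * t))
    (hφ1 : cross (trigPoint (polarSet (unitBall N)) φ) (V φ) = 1)
    (ht1 : cross (trigPoint (polarSet (unitBall N)) (φ + ω * t)) (V (φ + ω * t)) = 1) :
    jacobian N φ ω r t =
      |r ^ 3 * t / ω ^ 4 * reducedJacobian (trigPoint (polarSet (unitBall N))) V φ (ω * t)| := by
  set P := trigPoint (polarSet (unitBall N)) with hP
  set c : ℝ → ℝ := fun θ => (P θ).1 with hc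
  set s : ℝ → ℝ := fun θ => (P θ).2 with hs
  have hωn : ∀ᶠ w in 𝓝 ω, w ≠ 0 := eventually_ne_nhds hω
  have eX : ∀ φ' w r', w ≠ 0 → expX N φ' w r' t = r' / w * (s (φ' + w * t) - s φ') :=
    fun φ' w r' hw => by simp only [expX, if_neg hw]; rfl
  have eY : ∀ φ' w r', w ≠ 0 → expY N φ' w r' t = -(r' / w) * (c (φ' + w * t) - c φ') :=
    fun φ' w r' hw => by simp only [expY, if_neg hw]; rfl
  have eZ : ∀ φ' w r', w ≠ 0 → expZ N φ' w r' t = r' ^ 2 / (2 * w ^ 2) *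
      (w * t + c (φ' + w * t) * s φ' - s (φ' + w * t) * c φ') :=
    fun φ' w r' hw => by simp only [expZ, if_neg hw]; rfl
  have dc0 : HasDerivAt c (V φ).1 φ := hφ.fst
  have ds0 : HasDerivAt s (V φ).2 φ := hφ.snd
  have dc1 : HasDerivAt c (V (φ + ω * t)).1 (φ + ω * t) := ht.fst
  have ds1 : HasDerivAt s (V (φ + ω * t)).2 (φ + ω * t) := ht.snd
  have dcφ : HasDerivAt (fun x => c (x + ω * t)) (V (φ + ω * t)).1 φ := dc1.comp_add_const φ _
  have dsφ : HasDerivAt (fun x => s (x + ω * t)) (V (φ + ω * t)).2 φ := ds1.comp_add_const φ _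
  have dl : HasDerivAt (fun w => φ + w * t) t ω := by
    simpa using (hasDerivAt_mul_const t (x := ω)).const_add φ
  have dcω : HasDerivAt (fun w => c (φ + w * t)) ((V (φ + ω * t)).1 * t) ω :=
    HasDerivAt.comp (h := fun w => φ + w * t) ω dc1 dl
  have dsω : HasDerivAt (fun w => s (φ + w * t)) ((V (φ + ω * t)).2 * t) ω :=
    HasDerivAt.comp (h := fun w => φ + w * t) ω ds1 dl
  have dinv : HasDerivAt (fun w => r / w) (-(r / ω ^ 2)) ω := by
    simpa [div_eq_mul_inv] using (hasDerivAt_inv hω).const_mul r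
  have dinv2 : HasDerivAt (fun w => r ^ 2 / (2 * w ^ 2)) (-(r ^ 2 / ω ^ 3)) ω := by
    have h2 : HasDerivAt (fun w : ℝ => 2 * w ^ 2) (2 * (2 * ω)) ω := by
      simpa using (hasDerivAt_pow 2 ω).const_mul 2
    have := (h2.inv (mul_ne_zero two_ne_zero (pow_ne_zero 2 hω))).const_mul (r ^ 2)
    refine (this.congr_deriv ?_).congr_of_eventuallyEq (Eventually.of_forall fun w => ?_)
    · field_simp
    · simp [div_eq_mul_inv]
  have dXr : deriv (fun r' => expX N φ ω r' t) r = 1 / ω * (s (φ + ω * t) - s φ) := by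
    simp only [eX _ _ _ hω]
    exact (((hasDerivAt_id r).div_const ω).mul_const _).deriv
  have dYr : deriv (fun r' => expY N φ ω r' t) r = -(1 / ω) * (c (φ + ω * t) - c φ) := by
    simp only [eY _ _ _ hω]
    exact (((hasDerivAt_id r).div_const ω).neg.mul_const _).deriv
  have dZr : deriv (fun r' => expZ N φ ω r' t) r = 2 * r / (2 * ω ^ 2) *
      (ω * t + c (φ + ω * t) * s φ - s (φ + ω * t) * c φ) := by
    simp only [eZ _ _ _ hω]
    simp
  have dXφ : deriv (fun x => expX N x ω r t) φ =
      r / ω * ((V (φ + ω * t)).2 - (V φ).2) := by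
    simp only [eX _ _ _ hω]
    exact ((dsφ.sub ds0).const_mul _).deriv
  have dYφ : deriv (fun x => expY N x ω r t) φ =
      -(r / ω) * ((V (φ + ω * t)).1 - (V φ).1) := by
    simp only [eY _ _ _ hω]
    exact ((dcφ.sub dc0).const_mul _).deriv
  have dZφ : deriv (fun x => expZ N x ω r t) φ = r ^ 2 / (2 * ω ^ 2) *
      (((V (φ + ω * t)).1 * s φ + c (φ + ω * t) * (V φ).2) -
        ((V (φ + ω * t)).2 * c φ + s (φ + ω * t) * (V φ).1)) := by
    simp only [eZ _ _ _ hω]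
    exact ((((dcφ.mul ds0).const_add (ω * t)).sub (dsφ.mul dc0)).const_mul _).deriv
  have dXω : deriv (fun w => expX N φ w r t) ω =
      -(r / ω ^ 2) * (s (φ + ω * t) - s φ) + r / ω * ((V (φ + ω * t)).2 * t) := by
    have h : HasDerivAt (fun w => r / w * (s (φ + w * t) - s φ)) _ ω :=
      dinv.mul (dsω.sub_const (s φ))
    exact (h.congr_of_eventuallyEq (hωn.mono fun w hw => eX _ _ _ hw)).deriv
  have dYω : deriv (fun w => expY N φ w r t) ω =
      - -(r / ω ^ 2) * (c (φ + ω * t) - c φ) + -(r / ω) * ((V (φ + ω * t)).1 * t) := by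
    have h : HasDerivAt (fun w => -(r / w) * (c (φ + w * t) - c φ)) _ ω :=
      dinv.neg.mul (dcω.sub_const (c φ))
    exact (h.congr_of_eventuallyEq (hωn.mono fun w hw => eY _ _ _ hw)).deriv
  have dZω : deriv (fun w => expZ N φ w r t) ω =
      -(r ^ 2 / ω ^ 3) * (ω * t + c (φ + ω * t) * s φ - s (φ + ω * t) * c φ) +
        r ^ 2 / (2 * ω ^ 2) *
          (t + (V (φ + ω * t)).1 * t * s φ - (V (φ + ω * t)).2 * t * c φ) := by
    have h1 : HasDerivAt (fun w : ℝ => w * t) t ω := hasDerivAt_mul_const t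
    have h : HasDerivAt (fun w => r ^ 2 / (2 * w ^ 2) *
        (w * t + c (φ + w * t) * s φ - s (φ + w * t) * c φ)) _ ω :=
      dinv2.mul ((h1.add (dcω.mul_const (s φ))).sub (dsω.mul_const (c φ)))
    exact (h.congr_of_eventuallyEq (hωn.mono fun w hw => eZ _ _ _ hw)).deriv
  unfold jacobian
  rw [Matrix.det_fin_three, dXr, dYr, dZr, dXφ, dYφ, dZφ, dXω, dYω, dZω]
  congr 1
  simp only [Matrix.of_apply, Matrix.cons_val', Matrix.cons_val_zero, Matrix.cons_val_one,
    Matrix.cons_val_fin_one, Matrix.cons_val, reducedJacobian, cross]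
  simp only [cross] at hφ1 ht1
  simp only [hc, hs]
  generalize (P φ).1 = c0 at *
  generalize (P φ).2 = s0 at *
  generalize (P (φ + ω * t)).1 = c1 at *
  generalize (P (φ + ω * t)).2 = s1 at *
  generalize (V φ).1 = u0 at *
  generalize (V φ).2 = v0 at *
  generalize (V (φ + ω * t)).1 = u1 at *
  generalize (V (φ + ω * t)).2 = v1 at *
  -- in terms of `ω * t` instead of `t`, both sides are multiples of a power of `ω⁻¹`
  obtain ⟨τ, rfl⟩ : ∃ τ, t = τ * ω⁻¹ := ⟨t * ω, by field_simp⟩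
  have hτ : ω * (τ * ω⁻¹) = τ := by field_simp
  rw [hτ]
  linear_combination r ^ 3 * τ / ω ^ 5 * ((1 - (c0 * v1 - s0 * u1)) / 2 * (hφ1 + ht1) +
    ((u0 * s1 - v0 * c1) + (c0 * v1 - s0 * u1)) / 2 * ht1)

theorem differentiableAt_expMap (N : Seminorm ℝ (ℝ × ℝ)) {φ ω r t : ℝ} (hω : ω ≠ 0)
    (hφ : DifferentiableAt ℝ (trigPoint (polarSet (unitBall N))) φ)
    (ht : DifferentiableAt ℝ (trigPoint (polarSet (unitBall N))) (φ + ω * t)) :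
    DifferentiableAt ℝ (fun p : ℝ × ℝ × ℝ => expMap N p.1 p.2.1 p.2.2 t) (φ, ω, r) := by
  set P := trigPoint (polarSet (unitBall N)) with hP
  have h0 : DifferentiableAt ℝ (fun p : ℝ × ℝ × ℝ => P p.1) (φ, ω, r) :=
    DifferentiableAt.comp (f := fun p : ℝ × ℝ × ℝ => p.1) (φ, ω, r) hφ differentiableAt_fst
  have h1 : DifferentiableAt ℝ (fun p : ℝ × ℝ × ℝ => P (p.1 + p.2.1 * t)) (φ, ω, r) :=
    DifferentiableAt.comp (f := fun p : ℝ × ℝ × ℝ => p.1 + p.2.1 * t) (φ, ω, r) ht (by fun_prop)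
  have hc0 := h0.fst
  have hs0 := h0.snd
  have hc1 := h1.fst
  have hs1 := h1.snd
  have hev : ∀ᶠ p : ℝ × ℝ × ℝ in 𝓝 (φ, ω, r), p.2.1 ≠ 0 :=
    (continuous_snd.fst.tendsto (φ, ω, r)).eventually_ne hω
  have hmain : DifferentiableAt ℝ (fun p : ℝ × ℝ × ℝ =>
      (p.2.2 / p.2.1 * ((P (p.1 + p.2.1 * t)).2 - (P p.1).2),
        -(p.2.2 / p.2.1) * ((P (p.1 + p.2.1 * t)).1 - (P p.1).1),
        p.2.2 ^ 2 / (2 * p.2.1 ^ 2) * (p.2.1 * t + (P (p.1 + p.2.1 * t)).1 * (P p.1).2 -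
          (P (p.1 + p.2.1 * t)).2 * (P p.1).1))) (φ, ω, r) := by
    have hne : 2 * ω ^ 2 ≠ 0 := mul_ne_zero two_ne_zero (pow_ne_zero 2 hω)
    fun_prop (disch := assumption)
  refine hmain.congr_of_eventuallyEq (hev.mono fun p hp => ?_)
  simp only [expMap, expX, expY, expZ, if_neg hp]
  rfl

/-- At an angle where the curve has nonzero affine curvature `k`, the ratio `J / |t|⁵` tends to
`r³ k² / 12`. -/
theorem HasAffineCurvature.jacobian_bounds (N : Seminorm ℝ (ℝ × ℝ)) {V : ℝ → ℝ × ℝ} {φ k : ℝ}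
    (H : HasAffineCurvature (trigPoint (polarSet (unitBall N))) V φ k) (hk : k ≠ 0)
    {ε r ω : ℝ} (hε : 0 < ε) (hε1 : ε < 1) (hr : 0 < r) (hω : ω ≠ 0) :
    ∃ C : ℝ, 0 < C ∧ ∃ ρ : ℝ, 0 < ρ ∧ ∀ t ∈ Icc (-ρ) ρ,
      DifferentiableAt ℝ (fun p : ℝ × ℝ × ℝ => expMap N p.1 p.2.1 p.2.2 t) (φ, ω, r) ∧
      C * (1 - ε) * |t| ^ 5 ≤ jacobian N φ ω r t ∧
      jacobian N φ ω r t ≤ C * (1 + ε) * |t| ^ 5 ∧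
      (t ≠ 0 → C * (1 - ε) * |t| ^ 5 < jacobian N φ ω r t ∧
        jacobian N φ ω r t < C * (1 + ε) * |t| ^ 5) := by
  set P := trigPoint (polarSet (unitBall N)) with hP
  have hk2 : 0 < k ^ 2 / 12 := by positivity
  have hω4 : 0 < ω ^ 4 := by positivity
  have hlin : Tendsto (fun t : ℝ => ω * t) (𝓝 0) (𝓝 0) := by
    simpa using (continuous_const_mul ω).tendsto 0
  have hshift : Tendsto (fun t : ℝ => φ + ω * t) (𝓝 0) (𝓝 φ) := by
    simpa using hlin.const_add φ
  have hF := H.tendsto_reducedJacobian.eventually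
    (Ioo_mem_nhds (show k ^ 2 / 12 * (1 - ε) < k ^ 2 / 12 by nlinarith)
      (show k ^ 2 / 12 < k ^ 2 / 12 * (1 + ε) by nlinarith))
  have hF' := hlin.eventually (eventually_nhdsWithin_iff.1 hF)
  have hall := (hshift.eventually H.hasDerivAt).and
    ((hshift.eventually H.cross_eq_one).and hF')
  obtain ⟨ρ, hρ, hball⟩ := Metric.eventually_nhds_iff.1 hall
  refine ⟨r ^ 3 * (k ^ 2 / 12), by positivity, ρ / 2, by positivity, fun t ht => ?_⟩
  have htρ : dist t 0 < ρ := by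
    rw [Real.dist_eq, sub_zero]
    linarith [abs_le.2 ht]
  obtain ⟨hd, h1, hFt⟩ := hball htρ
  have hJ := jacobian_eq N (r := r) hω H.hasDerivAt.self_of_nhds hd H.cross_eq_one.self_of_nhds h1
  refine ⟨differentiableAt_expMap N hω H.hasDerivAt.self_of_nhds.differentiableAt
    hd.differentiableAt, ?_⟩
  have hstrict : t ≠ 0 → r ^ 3 * (k ^ 2 / 12) * (1 - ε) * |t| ^ 5 < jacobian N φ ω r t ∧
      jacobian N φ ω r t < r ^ 3 * (k ^ 2 / 12) * (1 + ε) * |t| ^ 5 := by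
    intro ht0
    have hτ : ω * t ≠ 0 := mul_ne_zero hω ht0
    obtain ⟨hlow, hup⟩ := hFt hτ
    have hpos : 0 < r ^ 3 * |t| ^ 5 := by positivity
    have hR : 0 < reducedJacobian P V φ (ω * t) / (ω * t) ^ 4 :=
      (mul_pos hk2 (sub_pos.2 hε1)).trans hlow
    have e : r ^ 3 * t / ω ^ 4 * reducedJacobian P V φ (ω * t) =
        r ^ 3 * t ^ 5 * (reducedJacobian P V φ (ω * t) / (ω * t) ^ 4) := by
      field_simp
    have hJ' : jacobian N φ ω r t =
        r ^ 3 * |t| ^ 5 * (reducedJacobian P V φ (ω * t) / (ω * t) ^ 4) := by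
      rw [hJ, e, abs_mul, abs_mul, abs_of_pos hR, abs_pow t, abs_of_pos (pow_pos hr 3)]
    have h₁ := mul_lt_mul_of_pos_left hlow hpos
    have h₂ := mul_lt_mul_of_pos_left hup hpos
    rw [hJ']
    constructor <;> linarith
  by_cases ht0 : t = 0
  · subst ht0
    have : jacobian N φ ω r 0 = 0 := by rw [hJ]; simp
    simp [this]
  · exact ⟨(hstrict ht0).1.le, (hstrict ht0).2.le, hstrict⟩

/-! ### The support function of the unit ball -/

lemma dot_smul_left (a : ℝ) (v w : ℝ × ℝ) : dot (a • v) w = a * dot v w := by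
  simp only [dot, Prod.smul_fst, Prod.smul_snd, smul_eq_mul]; ring

lemma dot_smul_right (a : ℝ) (v w : ℝ × ℝ) : dot v (a • w) = a * dot v w := by
  simp only [dot, Prod.smul_fst, Prod.smul_snd, smul_eq_mul]; ring

lemma continuous_dot : Continuous (fun p : (ℝ × ℝ) × (ℝ × ℝ) => dot p.1 p.2) := by
  unfold dot; fun_prop

lemma abs_dot_le (v w : ℝ × ℝ) : |dot v w| ≤ 2 * ‖v‖ * ‖w‖ := by
  have h1 := mul_le_mul (norm_fst_le v) (norm_fst_le w) (norm_nonneg _) (norm_nonneg _)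
  have h2 := mul_le_mul (norm_snd_le v) (norm_snd_le w) (norm_nonneg _) (norm_nonneg _)
  rw [← norm_mul, Real.norm_eq_abs] at h1 h2
  have := abs_add_le (v.1 * w.1) (v.2 * w.2)
  simp only [dot]
  linarith

/-- The unit vector of Euclidean angle `α`. -/
noncomputable def dir (α : ℝ) : ℝ × ℝ := (Real.cos α, Real.sin α)

/-- The unit vector of Euclidean angle `α + π / 2`. -/
noncomputable def dirPerp (α : ℝ) : ℝ × ℝ := (-Real.sin α, Real.cos α)

lemma hasDerivAt_dir (α : ℝ) : HasDerivAt dir (dirPerp α) α :=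
  (Real.hasDerivAt_cos α).prodMk (Real.hasDerivAt_sin α)

lemma hasDerivAt_dirPerp (α : ℝ) : HasDerivAt dirPerp (-dir α) α :=
  (Real.hasDerivAt_sin α).neg.prodMk (Real.hasDerivAt_cos α)

lemma continuous_dir : Continuous dir := by unfold dir; fun_prop

lemma dir_ne_zero (α : ℝ) : dir α ≠ 0 := by
  intro h
  have h1 : Real.cos α = 0 := congrArg Prod.fst h
  have h2 : Real.sin α = 0 := congrArg Prod.snd h
  have := Real.sin_sq_add_cos_sq α
  simp [h1, h2] at this

lemma dot_dir_self (α : ℝ) : dot (dir α) (dir α) = 1 := by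
  have := Real.sin_sq_add_cos_sq α
  simp only [dot, dir]; linarith

lemma eq_dot_dir_smul_add (α : ℝ) (v : ℝ × ℝ) :
    v = dot (dir α) v • dir α + dot (dirPerp α) v • dirPerp α := by
  have := Real.sin_sq_add_cos_sq α
  ext
  · simp only [dot, dir, dirPerp, Prod.fst_add, Prod.smul_fst, smul_eq_mul]
    linear_combination -v.1 * this
  · simp only [dot, dir, dirPerp, Prod.snd_add, Prod.smul_snd, smul_eq_mul]
    linear_combination -v.2 * this

variable {N : Seminorm ℝ (ℝ × ℝ)}

lemma continuous_seminorm_prod (N : Seminorm ℝ (ℝ × ℝ)) : Continuous N := by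
  have hconv : ConvexOn ℝ univ N := N.convexOn
  exact continuousOn_univ.1 (hconv.continuousOn isOpen_univ)

lemma isCompact_unitBall (hN : ∀ v : ℝ × ℝ, N v = 0 → v = 0) : IsCompact (unitBall N) := by
  have hcont := continuous_seminorm_prod N
  have hclosed : IsClosed (unitBall N) := isClosed_le hcont continuous_const
  obtain ⟨w, hw, hmin⟩ := (isCompact_sphere (0 : ℝ × ℝ) 1).exists_isMinOn
    ⟨((1 : ℝ), (0 : ℝ)), by simp [Prod.norm_def]⟩ hcont.continuousOn
  have hw0 : w ≠ 0 := by
    rintro rfl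
    simp at hw
  have hm : 0 < N w := lt_of_le_of_ne (apply_nonneg N w) fun h => hw0 (hN w h.symm)
  refine Metric.isCompact_of_isClosed_isBounded hclosed
    (isBounded_iff_forall_norm_le.2 ⟨(N w)⁻¹, fun v hv => ?_⟩)
  rcases eq_or_ne v 0 with rfl | hv0
  · simp
  have hn : 0 < ‖v‖ := norm_pos_iff.2 hv0
  have h1 : N w ≤ N (‖v‖⁻¹ • v) := hmin (by simp [norm_smul, hn.ne'])
  rw [map_smul_eq_mul, norm_inv, norm_norm] at h1
  have h2 : N v ≤ 1 := hv
  rw [le_inv_comm₀ hn hm]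
  calc N w ≤ ‖v‖⁻¹ * N v := h1
    _ ≤ ‖v‖⁻¹ * 1 := by gcongr
    _ = ‖v‖⁻¹ := mul_one _

/-- `Q` is a support map of the unit ball: the point `Q α` maximizes the scalar product with the
unit vector of Euclidean angle `α`. -/
structure IsSupportMap (N : Seminorm ℝ (ℝ × ℝ)) (Q : ℝ → ℝ × ℝ) : Prop where
  mem : ∀ α, Q α ∈ unitBall N
  le : ∀ α, ∀ v ∈ unitBall N, dot (dir α) v ≤ dot (dir α) (Q α)

lemma exists_isSupportMap (hN : ∀ v : ℝ × ℝ, N v = 0 → v = 0) : ∃ Q, IsSupportMap N Q := by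
  have h : ∀ α, ∃ q ∈ unitBall N, ∀ v ∈ unitBall N, dot (dir α) v ≤ dot (dir α) q := by
    intro α
    have hc : Continuous fun v => dot (dir α) v := by unfold dot; fun_prop
    obtain ⟨q, hq, hmax⟩ := (isCompact_unitBall hN).exists_isMaxOn
      ⟨0, by simp [unitBall]⟩ hc.continuousOn
    exact ⟨q, hq, fun v hv => hmax hv⟩
  choose Q hQ hQ' using h
  exact ⟨Q, hQ, hQ'⟩

/-- The support function of the unit ball, as a function of the Euclidean angle, written with
a support map `Q`. -/
noncomputable def supp (Q : ℝ → ℝ × ℝ) (α : ℝ) : ℝ := dot (dir α) (Q α)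

/-- The derivative of the support function `supp Q`, provided that `Q` is continuous. -/
noncomputable def suppDeriv (Q : ℝ → ℝ × ℝ) (α : ℝ) : ℝ := dot (dirPerp α) (Q α)

lemma continuous_supp {Q : ℝ → ℝ × ℝ} (hQc : Continuous Q) : Continuous (supp Q) :=
  continuous_dot.comp (continuous_dir.prodMk hQc)

namespace IsSupportMap

variable {Q : ℝ → ℝ × ℝ}

lemma supp_pos (hQ : IsSupportMap N Q) (hN : ∀ v : ℝ × ℝ, N v = 0 → v = 0) (α : ℝ) :
    0 < supp Q α := by
  have hpos : 0 < N (dir α) :=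
    lt_of_le_of_ne (apply_nonneg N _) fun h => dir_ne_zero α (hN _ h.symm)
  have hmem : (N (dir α))⁻¹ • dir α ∈ unitBall N := by
    simp only [unitBall, mem_ofPred_eq, map_smul_eq_mul, norm_inv, Real.norm_eq_abs,
      abs_of_pos hpos]
    rw [inv_mul_cancel₀ hpos.ne']
  have := hQ.le α _ hmem
  rw [dot_smul_right, dot_dir_self, mul_one] at this
  exact (inv_pos.2 hpos).trans_le this

/-- For every vector, `⟨u, v⟩ ≤ h N(v)`, where `h` is the value of the support function at `u`. -/
lemma dot_le (hQ : IsSupportMap N Q) (hN : ∀ v : ℝ × ℝ, N v = 0 → v = 0) (α : ℝ) (v : ℝ × ℝ) :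
    dot (dir α) v ≤ supp Q α * N v := by
  rcases eq_or_ne v 0 with rfl | hv
  · simp [dot]
  have hpos : 0 < N v := lt_of_le_of_ne (apply_nonneg N _) fun h => hv (hN _ h.symm)
  have hmem : (N v)⁻¹ • v ∈ unitBall N := by
    simp only [unitBall, mem_ofPred_eq, map_smul_eq_mul, norm_inv, Real.norm_eq_abs,
      abs_of_pos hpos]
    rw [inv_mul_cancel₀ hpos.ne']
  have := hQ.le α _ hmem
  rwa [dot_smul_right, inv_mul_le_iff₀ hpos, mul_comm] at this

lemma seminorm_eq_one (hQ : IsSupportMap N Q) (hN : ∀ v : ℝ × ℝ, N v = 0 → v = 0) (α : ℝ) :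
    N (Q α) = 1 := by
  refine le_antisymm (hQ.mem α) ?_
  have h := hQ.dot_le hN α (Q α)
  have hpos := hQ.supp_pos hN α
  exact (le_mul_iff_one_le_right hpos).1 h

/-- By strict convexity, the maximizer is unique. -/
lemma unique (hQ : IsSupportMap N Q) (hN : ∀ v : ℝ × ℝ, N v = 0 → v = 0)
    (hconv : IsStrictlyConvexNorm N) {α : ℝ} {q : ℝ × ℝ} (hq : q ∈ unitBall N)
    (hmax : supp Q α ≤ dot (dir α) q) : q = Q α := by
  by_contra hne
  have h := hconv.2 (mem_univ q) (mem_univ (Q α)) hne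
    (show (0 : ℝ) < 1 / 2 by norm_num) (show (0 : ℝ) < 1 / 2 by norm_num) (by norm_num)
  simp only [smul_eq_mul] at h
  set m : ℝ × ℝ := (1 / 2 : ℝ) • q + (1 / 2 : ℝ) • Q α with hm
  have hq1 : N q ≤ 1 := hq
  have hq0 : 0 ≤ N q := apply_nonneg N q
  rw [hQ.seminorm_eq_one hN α] at h
  have hm1 : N m < 1 := by nlinarith [apply_nonneg N m]
  have hdm : supp Q α ≤ dot (dir α) m := by
    have e : dot (dir α) m = (1 / 2) * dot (dir α) q + (1 / 2) * supp Q α := by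
      simp only [hm, dot, supp, Prod.fst_add, Prod.snd_add, Prod.smul_fst, Prod.smul_snd,
        smul_eq_mul]
      ring
    linarith
  have := hQ.dot_le hN α m
  nlinarith [hQ.supp_pos hN α]

lemma continuous (hQ : IsSupportMap N Q) (hN : ∀ v : ℝ × ℝ, N v = 0 → v = 0)
    (hconv : IsStrictlyConvexNorm N) : Continuous Q := by
  refine continuous_iff_continuousAt.2 fun α => ?_
  refine (isCompact_unitBall hN).tendsto_nhds_of_unique_mapClusterPt
    (Eventually.of_forall hQ.mem) fun q hq hcl => hQ.unique hN hconv hq ?_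
  -- the graph of the relation "`q` is a maximizer for the angle `β`" is closed
  have hclosed : IsClosed {p : ℝ × (ℝ × ℝ) | dot (dir p.1) (Q α) ≤ dot (dir p.1) p.2} := by
    refine isClosed_le ?_ ?_
    · exact continuous_dot.comp ((continuous_dir.comp continuous_fst).prodMk continuous_const)
    · exact continuous_dot.comp ((continuous_dir.comp continuous_fst).prodMk continuous_snd)
  have hcl2 : MapClusterPt (α, q) (𝓝 α) fun β => (β, Q β) := by
    refine mapClusterPt_iff_frequently.2 fun s hs => ?_
    obtain ⟨U, hU, W, hW, hUW⟩ := mem_nhds_prod_iff.1 hs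
    exact ((mapClusterPt_iff_frequently.1 hcl W hW).and_eventually hU).mono
      fun β hβ => hUW ⟨hβ.2, hβ.1⟩
  exact hclosed.mem_of_mapClusterPt hcl2 (Eventually.of_forall fun β => hQ.le β _ (hQ.mem α))

/-- The support function is differentiable because the maximizer is unique. -/
lemma hasDerivAt_supp (hQ : IsSupportMap N Q) (hQc : Continuous Q) (α : ℝ) :
    HasDerivAt (supp Q) (suppDeriv Q α) α := by
  have hlin : HasDerivAt (fun β => dot (dir β) (Q α)) (suppDeriv Q α) α := by
    have h1 : HasDerivAt (fun β => (dir β).1) (dirPerp α).1 α := (hasDerivAt_dir α).fst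
    have h2 : HasDerivAt (fun β => (dir β).2) (dirPerp α).2 α := (hasDerivAt_dir α).snd
    exact (h1.mul_const _).add (h2.mul_const _)
  -- the error of the linear approximation is at most `⟨u_β - u_α, Q β - Q α⟩`
  have herr : HasDerivAt (fun β => supp Q β - dot (dir β) (Q α)) 0 α := by
    rw [hasDerivAt_iff_isLittleO]
    have hO : (fun β => dir β - dir α) =O[𝓝 α] fun β => β - α := (hasDerivAt_dir α).isBigO_sub
    have ho : (fun β => Q β - Q α) =o[𝓝 α] fun _ => (1 : ℝ) := by
      rw [Asymptotics.isLittleO_one_iff]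
      simpa using (hQc.tendsto α).sub_const (Q α)
    have hprod := hO.norm_left.mul_isLittleO ho.norm_left
    simp only [mul_one] at hprod
    refine Asymptotics.IsBigO.trans_isLittleO (Asymptotics.IsBigO.of_bound 2
      (Eventually.of_forall fun β => ?_)) hprod
    have h1 := hQ.le β _ (hQ.mem α)
    have h2 := hQ.le α _ (hQ.mem β)
    have h3 := abs_dot_le (dir β - dir α) (Q β - Q α)
    have h4 : dot (dir β - dir α) (Q β - Q α) = dot (dir β) (Q β) - dot (dir β) (Q α) -
        dot (dir α) (Q β) + dot (dir α) (Q α) := by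
      simp only [dot, Prod.fst_sub, Prod.snd_sub]; ring
    simp only [supp, sub_self, sub_zero, smul_zero, Real.norm_eq_abs, norm_mul, abs_norm]
    rw [abs_of_nonneg (by linarith), ← mul_assoc]
    have h5 := le_abs_self (dot (dir β - dir α) (Q β - Q α))
    linarith
  refine ((hlin.add herr).congr_deriv (add_zero _)).congr_of_eventuallyEq
    (Eventually.of_forall fun β => ?_)
  simp

lemma exists_supp_le (hQ : IsSupportMap N Q) (hN : ∀ v : ℝ × ℝ, N v = 0 → v = 0) :
    ∃ M, 0 < M ∧ ∀ α, supp Q α ≤ M := by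
  obtain ⟨R, hR⟩ := isBounded_iff_forall_norm_le.1 (isCompact_unitBall hN).isBounded
  have hle : ∀ α, supp Q α ≤ 2 * R := fun α => by
    have h1 := (le_abs_self _).trans (abs_dot_le (dir α) (Q α))
    have h2 : ‖dir α‖ ≤ 1 := by
      simp only [dir, Prod.norm_def, Real.norm_eq_abs]
      exact max_le (Real.abs_cos_le_one α) (Real.abs_sin_le_one α)
    have h3 := hR _ (hQ.mem α)
    calc supp Q α ≤ 2 * ‖dir α‖ * ‖Q α‖ := h1
      _ ≤ 2 * 1 * R := by gcongr
      _ = 2 * R := by ring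
  exact ⟨2 * R, (hQ.supp_pos hN 0).trans_le (hle 0), hle⟩

/-- The support function is semiconvex: its derivative becomes monotone after adding a multiple
of the angle. -/
lemma exists_monotone_suppDeriv_add (hQ : IsSupportMap N Q)
    (hN : ∀ v : ℝ × ℝ, N v = 0 → v = 0) :
    ∃ M, Monotone fun α => suppDeriv Q α + M * α := by
  obtain ⟨M, hM, hle⟩ := hQ.exists_supp_le hN
  refine ⟨2 * M, ?_⟩
  have key : ∀ α δ, 0 ≤ δ → δ ≤ 1 →
      suppDeriv Q α + 2 * M * α ≤ suppDeriv Q (α + δ) + 2 * M * (α + δ) := by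
    intro α δ h0 h1
    rcases h0.eq_or_lt with rfl | h0
    · simp
    have hs : 0 < Real.sin δ := Real.sin_pos_of_pos_of_lt_pi h0 (by linarith [Real.pi_gt_three])
    -- compare the support points of `α` and `α + δ` in both directions
    have e1 : dot (dir α) (Q (α + δ)) =
        supp Q (α + δ) * Real.cos δ - suppDeriv Q (α + δ) * Real.sin δ := by
      have h := Real.sin_sq_add_cos_sq δ
      simp only [supp, suppDeriv, dot, dir, dirPerp, Real.cos_add, Real.sin_add]
      linear_combination (-(Real.cos α * (Q (α + δ)).1) - Real.sin α * (Q (α + δ)).2) * h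
    have e2 : dot (dir (α + δ)) (Q α) =
        supp Q α * Real.cos δ + suppDeriv Q α * Real.sin δ := by
      simp only [supp, suppDeriv, dot, dir, dirPerp, Real.cos_add, Real.sin_add]
      ring
    have i1 : dot (dir α) (Q (α + δ)) ≤ supp Q α := hQ.le α _ (hQ.mem _)
    have i2 : dot (dir (α + δ)) (Q α) ≤ supp Q (α + δ) := hQ.le _ _ (hQ.mem α)
    rw [e1] at i1
    rw [e2] at i2
    have hcos : 1 - Real.cos δ ≤ Real.sin δ * δ := by
      have b1 := Real.one_sub_sq_div_two_le_cos (x := δ)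
      have b2 := Real.mul_le_sin h0.le (by linarith [Real.pi_gt_three])
      have b3 : 1 / 2 ≤ 2 / Real.pi := by
        rw [div_le_div_iff₀ two_pos Real.pi_pos]
        linarith [Real.pi_le_four]
      nlinarith
    have hc0 : 0 ≤ 1 - Real.cos δ := sub_nonneg.2 (Real.cos_le_one δ)
    have h3 : (supp Q α + supp Q (α + δ)) * (1 - Real.cos δ) ≤ 2 * M * (Real.sin δ * δ) := by
      have := hle α
      have := hle (α + δ)
      apply mul_le_mul (by linarith) hcos hc0 (by linarith)
    have h4 : Real.sin δ * (suppDeriv Q α) ≤ Real.sin δ * (suppDeriv Q (α + δ) + 2 * M * δ) := by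
      nlinarith
    have h5 := le_of_mul_le_mul_left h4 hs
    linarith
  -- increments of length at most `1` add up to arbitrary ones
  have hnat : ∀ n : ℕ, ∀ α δ : ℝ, 0 ≤ δ → δ ≤ n →
      suppDeriv Q α + 2 * M * α ≤ suppDeriv Q (α + δ) + 2 * M * (α + δ) := by
    intro n
    induction n with
    | zero =>
      intro α δ h0 h1
      have : δ = 0 := le_antisymm (by simpa using h1) h0
      simp [this]
    | succ n ih =>
      intro α δ h0 h1
      rcases le_total δ 1 with h | h
      · exact key α δ h0 h
      · have a1 := key α 1 zero_le_one le_rfl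
        have a2 := ih (α + 1) (δ - 1) (by linarith) (by push_cast at h1; linarith)
        rw [show α + 1 + (δ - 1) = α + δ by ring] at a2
        exact a1.trans a2
  intro α β hαβ
  obtain ⟨n, hn⟩ := exists_nat_ge (β - α)
  have := hnat n α (β - α) (by linarith) hn
  rwa [show α + (β - α) = β by ring] at this

/-- The differential of the norm at the point `Q α` is the point of the boundary of `Ω°` of
Euclidean angle `α`. -/
lemma fderiv_apply (hQ : IsSupportMap N Q) (hN : ∀ v : ℝ × ℝ, N v = 0 → v = 0)
    (hd : DifferentiableOn ℝ (fun v : ℝ × ℝ => N v) {0}ᶜ) (α : ℝ) (v : ℝ × ℝ) :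
    fderiv ℝ (fun v : ℝ × ℝ => N v) (Q α) v = dot ((supp Q α)⁻¹ • dir α) v := by
  have hpos := hQ.supp_pos hN α
  have hQ0 : Q α ≠ 0 := by
    intro h
    simp [supp, h, dot] at hpos
  have hdN : HasFDerivAt (fun v : ℝ × ℝ => N v) (fderiv ℝ (fun v : ℝ × ℝ => N v) (Q α)) (Q α) :=
    ((hd _ hQ0).differentiableAt (isOpen_compl_singleton.mem_nhds hQ0)).hasFDerivAt
  set ℓ : (ℝ × ℝ) →L[ℝ] ℝ :=
    ((supp Q α)⁻¹ * (dir α).1) • ContinuousLinearMap.fst ℝ ℝ ℝ +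
      ((supp Q α)⁻¹ * (dir α).2) • ContinuousLinearMap.snd ℝ ℝ ℝ with hℓ
  have hℓa : ∀ v, ℓ v = dot ((supp Q α)⁻¹ • dir α) v := fun v => by simp [hℓ, dot]
  -- `N - ⟨u / h, ·⟩` is nonnegative and vanishes at `Q α`
  have hmin : IsLocalMin (fun v => N v - ℓ v) (Q α) := by
    refine Eventually.of_forall fun v => ?_
    have h1 := hQ.dot_le hN α v
    simp only [hℓa, dot_smul_left, hQ.seminorm_eq_one hN α]
    change 1 - (supp Q α)⁻¹ * supp Q α ≤ _
    rw [inv_mul_cancel₀ hpos.ne', sub_self, sub_nonneg, inv_mul_le_iff₀ hpos]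
    exact h1
  have := hmin.hasFDerivAt_eq_zero (hdN.sub ℓ.hasFDerivAt)
  rw [sub_eq_zero.1 this, hℓa]

lemma gauge_polarSet (hQ : IsSupportMap N Q) (hN : ∀ v : ℝ × ℝ, N v = 0 → v = 0) (α : ℝ) :
    gauge (polarSet (unitBall N)) (dir α) = supp Q α := by
  have hpos := hQ.supp_pos hN α
  rw [gauge_def']
  have : {r : ℝ | r ∈ Ioi 0 ∧ r⁻¹ • dir α ∈ polarSet (unitBall N)} = Ici (supp Q α) := by
    ext r
    constructor
    · rintro ⟨hr, h⟩
      have := h (Q α) (hQ.mem α)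
      rwa [dot_smul_left, inv_mul_le_iff₀ hr, mul_one] at this
    · intro hr
      have hr0 : 0 < r := hpos.trans_le hr
      refine ⟨hr0, fun v hv => ?_⟩
      rw [dot_smul_left, inv_mul_le_iff₀ hr0, mul_one]
      exact (hQ.le α v hv).trans hr
  rw [this, csInf_Ici]

lemma smul_dir_mem_polarSet_iff (hQ : IsSupportMap N Q) {α s : ℝ} (hs : 0 ≤ s) :
    s • dir α ∈ polarSet (unitBall N) ↔ s * supp Q α ≤ 1 := by
  constructor
  · intro h
    have := h (Q α) (hQ.mem α)
    rwa [dot_smul_left] at this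
  · intro h v hv
    rw [dot_smul_left]
    exact (mul_le_mul_of_nonneg_left (hQ.le α v hv) hs).trans h

lemma boundaryPoint_polarSet (hQ : IsSupportMap N Q) (hN : ∀ v : ℝ × ℝ, N v = 0 → v = 0)
    (α : ℝ) : boundaryPoint (polarSet (unitBall N)) α = (supp Q α)⁻¹ • dir α := by
  rw [← hQ.gauge_polarSet hN α]
  rfl

end IsSupportMap

/-! ### Areas of sectors of the polar set -/

/-- Polar coordinates are injective away from the origin for angles in `[0, 2π)`. -/
lemma injOn_polarCoord_symm :
    InjOn polarCoord.symm {p : ℝ × ℝ | 0 < p.1 ∧ p.2 ∈ Ico 0 (2 * Real.pi)} := by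
  rintro ⟨s, β⟩ ⟨hs, hβ⟩ ⟨s', β'⟩ ⟨hs', hβ'⟩ h
  simp only at hs hs' hβ hβ'
  have h1 : s * Real.cos β = s' * Real.cos β' := congrArg Prod.fst h
  have h2 : s * Real.sin β = s' * Real.sin β' := congrArg Prod.snd h
  have hss : s = s' := by
    have : s ^ 2 = s' ^ 2 := by
      have e1 := Real.sin_sq_add_cos_sq β
      have e2 := Real.sin_sq_add_cos_sq β'
      linear_combination (s * Real.cos β + s' * Real.cos β') * h1 +
        (s * Real.sin β + s' * Real.sin β') * h2 - s ^ 2 * e1 + s' ^ 2 * e2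
    exact (pow_left_inj₀ hs.le hs'.le two_ne_zero).1 this
  subst hss
  have hang := Real.Angle.cos_sin_inj (mul_left_cancel₀ hs.ne' h1) (mul_left_cancel₀ hs.ne' h2)
  obtain ⟨k, hk⟩ := Real.Angle.angle_eq_iff_two_pi_dvd_sub.1 hang
  have hpi := Real.pi_pos
  have hk1 : (k : ℝ) < 1 := by
    by_contra! hc
    nlinarith [hβ.1, hβ.2, hβ'.1, hβ'.2]
  have hk2 : (-1 : ℝ) < k := by
    by_contra! hc
    nlinarith [hβ.1, hβ.2, hβ'.1, hβ'.2]
  have hk0 : k = 0 := by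
    have a1 : k < 1 := by exact_mod_cast hk1
    have a2 : -1 < k := by exact_mod_cast hk2
    omega
  rw [hk0] at hk
  simp only [Int.cast_zero, mul_zero] at hk
  rw [sub_eq_zero.1 hk]

/-- The area of the part of `Ω°` seen from the origin under the angles in `T`. -/
lemma IsSupportMap.volume_real_sector (hQ : IsSupportMap N Q)
    (hN : ∀ v : ℝ × ℝ, N v = 0 → v = 0) (hQc : Continuous Q) {T : Set ℝ} (hT : MeasurableSet T)
    (hT2 : T ⊆ Ico 0 (2 * Real.pi)) :
    volume.real {p ∈ polarSet (unitBall N) |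
      ∃ s : ℝ, 0 ≤ s ∧ ∃ β ∈ T, p = (s * Real.cos β, s * Real.sin β)} =
      (∫ β in T, (supp Q β ^ 2)⁻¹) / 2 := by
  set A := {p ∈ polarSet (unitBall N) |
      ∃ s : ℝ, 0 ≤ s ∧ ∃ β ∈ T, p = (s * Real.cos β, s * Real.sin β)} with hA
  set S : Set (ℝ × ℝ) := {p | p.2 ∈ T ∧ 0 < p.1 ∧ p.1 * supp Q p.2 ≤ 1} with hS
  have hsuppc := continuous_supp hQc
  have hSm : MeasurableSet S := by
    refine (measurable_snd hT).inter ((measurableSet_lt measurable_const measurable_fst).inter ?_)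
    exact measurableSet_le (measurable_fst.mul (hsuppc.measurable.comp measurable_snd))
      measurable_const
  have hsub : polarCoord.symm '' S ⊆ A := by
    rintro _ ⟨⟨s, β⟩, ⟨hβ, hs, hle⟩, rfl⟩
    exact ⟨(hQ.smul_dir_mem_polarSet_iff (le_of_lt hs)).2 hle, s, le_of_lt hs, β, hβ, rfl⟩
  have hsub2 : A ⊆ polarCoord.symm '' S ∪ {0} := by
    rintro _ ⟨hp, s, hs, β, hβ, rfl⟩
    rcases hs.eq_or_lt with rfl | hs0
    · right; simp
    · exact Or.inl ⟨(s, β), ⟨hβ, hs0, (hQ.smul_dir_mem_polarSet_iff hs).1 hp⟩, rfl⟩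
  -- `A` contains at most the origin in addition to the image of `S`
  have hvol : volume A = volume (polarCoord.symm '' S) := by
    refine le_antisymm ((measure_mono hsub2).trans ((measure_union_le _ _).trans ?_))
      (measure_mono hsub)
    simp
  have hcv := lintegral_abs_det_fderiv_eq_addHaar_image volume hSm
    (fun p _ => (hasFDerivAt_polarCoord_symm p).hasFDerivWithinAt)
    (injOn_polarCoord_symm.mono fun p (hp : p ∈ S) => show 0 < p.1 ∧ p.2 ∈ Ico 0 (2 * Real.pi)
      from ⟨hp.2.1, hT2 hp.1⟩)
  simp only [det_fderivPolarCoordSymm] at hcv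
  have hslice : ∀ β, ∫⁻ s, S.indicator (fun p : ℝ × ℝ => ENNReal.ofReal |p.1|) (s, β) =
      T.indicator (fun β => ENNReal.ofReal ((supp Q β ^ 2)⁻¹ / 2)) β := by
    intro β
    by_cases hβ : β ∈ T
    · have hpos := hQ.supp_pos hN β
      have hinv : 0 ≤ (supp Q β)⁻¹ := (inv_pos.2 hpos).le
      rw [indicator_of_mem hβ]
      have e : (fun s => S.indicator (fun p : ℝ × ℝ => ENNReal.ofReal |p.1|) (s, β)) =
          (Ioc 0 (supp Q β)⁻¹).indicator (fun s => ENNReal.ofReal s) := by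
        funext s
        by_cases hs : s ∈ Ioc 0 (supp Q β)⁻¹
        · rw [indicator_of_mem hs, indicator_of_mem, abs_of_pos hs.1]
          refine ⟨hβ, hs.1, ?_⟩
          have := mul_le_mul_of_nonneg_right hs.2 hpos.le
          rwa [inv_mul_cancel₀ hpos.ne'] at this
        · rw [indicator_of_notMem hs, indicator_of_notMem]
          rintro ⟨-, h1, h2⟩
          refine hs ⟨h1, ?_⟩
          rw [← one_div, le_div_iff₀ hpos]
          exact h2
      rw [e, lintegral_indicator measurableSet_Ioc, ← ofReal_integral_eq_lintegral_ofReal]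
      · rw [← intervalIntegral.integral_of_le hinv, integral_id]
        simp
      · exact (intervalIntegrable_iff_integrableOn_Ioc_of_le hinv).1
          (continuous_id.intervalIntegrable _ _)
      · exact (ae_restrict_iff' measurableSet_Ioc).2 (Eventually.of_forall fun s hs => hs.1.le)
    · rw [indicator_of_notMem hβ]
      have e : (fun s => S.indicator (fun p : ℝ × ℝ => ENNReal.ofReal |p.1|) (s, β)) =
          fun _ => 0 := by
        funext s
        exact indicator_of_notMem (fun h => hβ h.1) _
      simp [e]
  have hcont : Continuous fun β => (supp Q β ^ 2)⁻¹ / 2 :=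
    ((hsuppc.pow 2).inv₀ fun β => (pow_pos (hQ.supp_pos hN β) 2).ne').div_const 2
  have hfin : IntegrableOn (fun β => (supp Q β ^ 2)⁻¹ / 2) T :=
    (hcont.integrableOn_Icc (a := 0) (b := 2 * Real.pi)).mono_set
      (hT2.trans Ico_subset_Icc_self)
  have hnn : ∀ β, 0 ≤ (supp Q β ^ 2)⁻¹ / 2 := fun β => by positivity
  rw [Measure.real, hvol, ← hcv, ← lintegral_indicator hSm, Measure.volume_eq_prod,
    lintegral_prod_symm _
      (((measurable_fst.abs.ennreal_ofReal).indicator hSm).aemeasurable)]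
  simp only [hslice]
  rw [lintegral_indicator hT, ← ofReal_integral_eq_lintegral_ofReal hfin
      (Eventually.of_forall hnn), ENNReal.toReal_ofReal (integral_nonneg hnn), integral_div]

/-- Twice the area of the sector of `Ω°` between the Euclidean angles `0` and `α`. -/
noncomputable def sweep (Q : ℝ → ℝ × ℝ) (α : ℝ) : ℝ := ∫ β in (0 : ℝ)..α, (supp Q β ^ 2)⁻¹

lemma IsSupportMap.sectorArea_eq (hQ : IsSupportMap N Q)
    (hN : ∀ v : ℝ × ℝ, N v = 0 → v = 0) (hQc : Continuous Q) {α : ℝ}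
    (hα : α ∈ Ico 0 (2 * Real.pi)) :
    sectorArea (polarSet (unitBall N)) α = sweep Q α / 2 := by
  have := hQ.volume_real_sector hN hQc (measurableSet_Icc (a := 0) (b := α))
    (fun β hβ => ⟨hβ.1, hβ.2.trans_lt hα.2⟩)
  rw [sectorArea, this, sweep, intervalIntegral.integral_of_le hα.1, integral_Icc_eq_integral_Ioc]

lemma IsSupportMap.area_polarSet_eq (hQ : IsSupportMap N Q)
    (hN : ∀ v : ℝ × ℝ, N v = 0 → v = 0) (hQc : Continuous Q) :
    area (polarSet (unitBall N)) = sweep Q (2 * Real.pi) / 2 := by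
  have := hQ.volume_real_sector hN hQc (measurableSet_Ico (a := 0) (b := 2 * Real.pi)) subset_rfl
  rw [sweep, intervalIntegral.integral_of_le Real.two_pi_pos.le, ← integral_Ico_eq_integral_Ioc,
    ← this, area]
  congr 1
  ext p
  refine ⟨fun hp => ⟨hp, ?_⟩, fun hp => hp.1⟩
  set z : ℂ := ⟨p.1, p.2⟩ with hz
  refine ⟨‖z‖, norm_nonneg z, toIcoMod Real.two_pi_pos 0 z.arg, ?_, ?_⟩
  · simpa using toIcoMod_mem_Ico Real.two_pi_pos 0 z.arg
  · have e : toIcoMod Real.two_pi_pos 0 z.arg =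
        z.arg - toIcoDiv Real.two_pi_pos 0 z.arg * (2 * Real.pi) := by
      rw [toIcoMod, zsmul_eq_mul]
    rw [e, Real.cos_sub_int_mul_two_pi, Real.sin_sub_int_mul_two_pi, Complex.norm_mul_cos_arg,
      Complex.norm_mul_sin_arg]

lemma hasDerivAt_sweep (hQ : IsSupportMap N Q) (hN : ∀ v : ℝ × ℝ, N v = 0 → v = 0)
    (hQc : Continuous Q) (α : ℝ) : HasDerivAt (sweep Q) (supp Q α ^ 2)⁻¹ α := by
  have hc : Continuous fun β => (supp Q β ^ 2)⁻¹ :=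
    ((continuous_supp hQc).pow 2).inv₀ fun β => (pow_pos (hQ.supp_pos hN β) 2).ne'
  exact intervalIntegral.integral_hasDerivAt_right (hc.intervalIntegrable _ _)
    (hc.stronglyMeasurableAtFilter _ _) hc.continuousAt

/-! ### The curve `θ ↦ (cos θ, sin θ)` of the polar set -/

lemma strictMono_sweep (hQ : IsSupportMap N Q) (hN : ∀ v : ℝ × ℝ, N v = 0 → v = 0)
    (hQc : Continuous Q) : StrictMono (sweep Q) :=
  strictMono_of_hasDerivAt_pos (hasDerivAt_sweep hQ hN hQc)
    fun α => inv_pos.2 (pow_pos (hQ.supp_pos hN α) 2)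

lemma continuous_sweep (hQ : IsSupportMap N Q) (hN : ∀ v : ℝ × ℝ, N v = 0 → v = 0)
    (hQc : Continuous Q) : Continuous (sweep Q) :=
  continuous_iff_continuousAt.2 fun α => (hasDerivAt_sweep hQ hN hQc α).continuousAt

/-- Inside the period the Euclidean angle inverts the sweep function. -/
lemma sweep_euclideanAngle (hQ : IsSupportMap N Q) (hN : ∀ v : ℝ × ℝ, N v = 0 → v = 0)
    (hQc : Continuous Q) {θ : ℝ} (hθ : θ ∈ Ioo 0 (2 * area (polarSet (unitBall N)))) :
    sweep Q (euclideanAngle (polarSet (unitBall N)) θ) = θ := by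
  have harea := hQ.area_polarSet_eq hN hQc
  have hred : reduceAngle (polarSet (unitBall N)) θ = θ := by
    have hpos : 0 < 2 * area (polarSet (unitBall N)) := hθ.1.trans hθ.2
    rw [reduceAngle, Int.fract_eq_self.2 ⟨(div_pos hθ.1 hpos).le, (div_lt_one hpos).2 hθ.2⟩,
      mul_div_cancel₀ _ hpos.ne']
  have hex : ∃ α ∈ Ico 0 (2 * Real.pi), sectorArea (polarSet (unitBall N)) α =
      reduceAngle (polarSet (unitBall N)) θ / 2 := by
    have h0 : sweep Q 0 = 0 := by simp [sweep]
    have h2 : sweep Q (2 * Real.pi) = 2 * area (polarSet (unitBall N)) := by linarith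
    obtain ⟨α, hα, hαθ⟩ := intermediate_value_Icc Real.two_pi_pos.le
      (continuous_sweep hQ hN hQc).continuousOn
      (show θ ∈ Icc (sweep Q 0) (sweep Q (2 * Real.pi)) by
        rw [h0, h2]; exact ⟨hθ.1.le, hθ.2.le⟩)
    -- the value `2π`, which is not a Euclidean angle of the period, has the sweep `2𝕊`
    have hne : α ≠ 2 * Real.pi := by
      rintro rfl
      exact hθ.2.ne (hαθ.symm.trans h2)
    have hα' : α ∈ Ico 0 (2 * Real.pi) := ⟨hα.1, lt_of_le_of_ne hα.2 hne⟩
    exact ⟨α, hα', by rw [hQ.sectorArea_eq hN hQc hα', hαθ, hred]⟩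
  have hmem := Function.invFunOn_mem hex
  have heq := Function.invFunOn_eq hex
  rw [hQ.sectorArea_eq hN hQc hmem, hred] at heq
  rw [euclideanAngle, hred]
  linarith

lemma hasDerivAt_euclideanAngle (hQ : IsSupportMap N Q) (hN : ∀ v : ℝ × ℝ, N v = 0 → v = 0)
    (hQc : Continuous Q) {θ : ℝ} (hθ : θ ∈ Ioo 0 (2 * area (polarSet (unitBall N)))) :
    HasDerivAt (euclideanAngle (polarSet (unitBall N)))
      (supp Q (euclideanAngle (polarSet (unitBall N)) θ) ^ 2) θ := by
  have hev : ∀ᶠ x in 𝓝 θ, sweep Q (euclideanAngle (polarSet (unitBall N)) x) = x := by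
    filter_upwards [isOpen_Ioo.mem_nhds hθ] with x hx using sweep_euclideanAngle hQ hN hQc hx
  have hemb : IsEmbedding (sweep Q) :=
    (strictMono_sweep hQ hN hQc).isEmbedding_of_ordConnected
      (isPreconnected_range (continuous_sweep hQ hN hQc)).ordConnected
  have hcont : ContinuousAt (euclideanAngle (polarSet (unitBall N))) θ :=
    hemb.continuousAt_iff.2 (continuousAt_id.congr (hev.mono fun x hx => hx.symm))
  have hpos := hQ.supp_pos hN (euclideanAngle (polarSet (unitBall N)) θ)
  have := HasDerivAt.of_local_left_inverse hcont
    (hasDerivAt_sweep hQ hN hQc (euclideanAngle (polarSet (unitBall N)) θ))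
    (inv_pos.2 (pow_pos hpos 2)).ne' hev
  rwa [inv_inv] at this

/-- The velocity of the curve `θ ↦ (cos θ, sin θ)` of `Ω°`: the support point of `Ω` in the
direction of `(cos θ, sin θ)`, rotated by a right angle. -/
noncomputable def velocity (N : Seminorm ℝ (ℝ × ℝ)) (Q : ℝ → ℝ × ℝ) (θ : ℝ) : ℝ × ℝ :=
  (-(Q (euclideanAngle (polarSet (unitBall N)) θ)).2,
    (Q (euclideanAngle (polarSet (unitBall N)) θ)).1)

lemma trigPoint_polarSet (hQ : IsSupportMap N Q) (hN : ∀ v : ℝ × ℝ, N v = 0 → v = 0) (θ : ℝ) :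
    trigPoint (polarSet (unitBall N)) θ =
      (supp Q (euclideanAngle (polarSet (unitBall N)) θ))⁻¹ •
        dir (euclideanAngle (polarSet (unitBall N)) θ) :=
  hQ.boundaryPoint_polarSet hN _

lemma cross_trigPoint_velocity (hQ : IsSupportMap N Q) (hN : ∀ v : ℝ × ℝ, N v = 0 → v = 0)
    (θ : ℝ) : cross (trigPoint (polarSet (unitBall N)) θ) (velocity N Q θ) = 1 := by
  rw [trigPoint_polarSet hQ hN]
  set α := euclideanAngle (polarSet (unitBall N)) θ with hα
  have hpos := hQ.supp_pos hN α
  have : cross ((supp Q α)⁻¹ • dir α) (velocity N Q θ) = (supp Q α)⁻¹ * supp Q α := by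
    simp only [cross, velocity, supp, dot, ← hα, Prod.smul_fst, Prod.smul_snd, smul_eq_mul]
    ring
  rw [this, inv_mul_cancel₀ hpos.ne']

lemma hasDerivAt_trigPoint (hQ : IsSupportMap N Q) (hN : ∀ v : ℝ × ℝ, N v = 0 → v = 0)
    (hQc : Continuous Q) {θ : ℝ} (hθ : θ ∈ Ioo 0 (2 * area (polarSet (unitBall N)))) :
    HasDerivAt (trigPoint (polarSet (unitBall N))) (velocity N Q θ) θ := by
  have hu := hasDerivAt_euclideanAngle hQ hN hQc hθ
  set u := euclideanAngle (polarSet (unitBall N)) with hudef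
  have hpos := hQ.supp_pos hN (u θ)
  have h1 : HasDerivAt (fun α => (supp Q α)⁻¹ • dir α)
      ((supp Q (u θ))⁻¹ • dirPerp (u θ) +
        (-suppDeriv Q (u θ) / supp Q (u θ) ^ 2) • dir (u θ)) (u θ) :=
    ((hQ.hasDerivAt_supp hQc (u θ)).inv hpos.ne').smul (hasDerivAt_dir (u θ))
  have h2 := (h1.scomp θ hu).congr_of_eventuallyEq
    (Eventually.of_forall fun x => trigPoint_polarSet hQ hN x)
  refine h2.congr_deriv ?_
  have hvel : velocity N Q θ = supp Q (u θ) • dirPerp (u θ) - suppDeriv Q (u θ) • dir (u θ) := by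
    have h := Real.sin_sq_add_cos_sq (u θ)
    ext
    · simp only [velocity, ← hudef, supp, suppDeriv, dot, dir, dirPerp, Prod.fst_sub,
        Prod.smul_fst, smul_eq_mul]
      linear_combination (Q (u θ)).2 * h
    · simp only [velocity, ← hudef, supp, suppDeriv, dot, dir, dirPerp, Prod.snd_sub,
        Prod.smul_snd, smul_eq_mul]
      linear_combination -(Q (u θ)).1 * h
  rw [hvel, smul_add, smul_smul, smul_smul, sub_eq_add_neg, ← neg_smul]
  congr 2 <;> field_simp

/-- By monotonicity of the support map, the velocity is differentiable almost everywhere. -/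
lemma ae_differentiableAt_velocity (hQ : IsSupportMap N Q) (hN : ∀ v : ℝ × ℝ, N v = 0 → v = 0)
    (hQc : Continuous Q) :
    ∀ᵐ θ ∂(volume.restrict (Ioo (0 : ℝ) (2 * area (polarSet (unitBall N))))),
      DifferentiableAt ℝ (velocity N Q) θ := by
  obtain ⟨M, hM⟩ := hQ.exists_monotone_suppDeriv_add hN
  set u := euclideanAngle (polarSet (unitBall N)) with hu
  have humono : MonotoneOn u (Ioo (0 : ℝ) (2 * area (polarSet (unitBall N)))) := by
    intro x hx y hy hxy
    rw [← (strictMono_sweep hQ hN hQc).le_iff_le, sweep_euclideanAngle hQ hN hQc hx,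
      sweep_euclideanAngle hQ hN hQc hy]
    exact hxy
  have hg : MonotoneOn (fun θ => suppDeriv Q (u θ) + M * u θ)
      (Ioo (0 : ℝ) (2 * area (polarSet (unitBall N)))) :=
    fun x hx y hy hxy => hM (humono hx hy hxy)
  filter_upwards [hg.ae_differentiableWithinAt measurableSet_Ioo,
    ae_restrict_mem measurableSet_Ioo] with θ hθ hmem
  have hdu : DifferentiableAt ℝ u θ := (hasDerivAt_euclideanAngle hQ hN hQc hmem).differentiableAt
  have hd1 : DifferentiableAt ℝ (fun θ => suppDeriv Q (u θ)) θ := by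
    have := (hθ.differentiableAt (isOpen_Ioo.mem_nhds hmem)).sub (hdu.const_mul M)
    refine this.congr_of_eventuallyEq (Eventually.of_forall fun x => ?_)
    simp
  have hd0 : DifferentiableAt ℝ (fun θ => supp Q (u θ)) θ :=
    (hQ.hasDerivAt_supp hQc (u θ)).differentiableAt.comp θ hdu
  have hdir : DifferentiableAt ℝ (fun θ => dir (u θ)) θ :=
    (hasDerivAt_dir (u θ)).differentiableAt.comp θ hdu
  have hdirPerp : DifferentiableAt ℝ (fun θ => dirPerp (u θ)) θ :=
    (hasDerivAt_dirPerp (u θ)).differentiableAt.comp θ hdu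
  have hQd : DifferentiableAt ℝ (fun θ => Q (u θ)) θ := by
    refine ((hd0.smul hdir).add (hd1.smul hdirPerp)).congr_of_eventuallyEq
      (Eventually.of_forall fun x => ?_)
    exact eq_dot_dir_smul_add (u x) (Q (u x))
  exact hQd.snd.neg.prodMk hQd.fst

/-- Since the differential of the norm maps `Q` to the curve of `Ω°` and is locally Lipschitz, the
curve moves at most a constant times as fast as its velocity does. -/
lemma exists_norm_trigPoint_sub_le (hQ : IsSupportMap N Q)
    (hN : ∀ v : ℝ × ℝ, N v = 0 → v = 0) (hC11 : IsC11Norm N) (hQc : Continuous Q) {θ : ℝ}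
    (hθ : θ ∈ Ioo 0 (2 * area (polarSet (unitBall N)))) :
    ∃ L : ℝ, ∀ᶠ x in 𝓝 θ, ‖trigPoint (polarSet (unitBall N)) x -
      trigPoint (polarSet (unitBall N)) θ‖ ≤ L * ‖velocity N Q x - velocity N Q θ‖ := by
  have huc := (hasDerivAt_euclideanAngle hQ hN hQc hθ).continuousAt
  have htrig := trigPoint_polarSet hQ hN
  set u := euclideanAngle (polarSet (unitBall N)) with hu
  have hQ0 : ∀ α, Q α ∈ ({0}ᶜ : Set (ℝ × ℝ)) := by
    intro α h
    have := hQ.supp_pos hN α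
    rw [mem_singleton_iff] at h
    simp [supp, h, dot] at this
  obtain ⟨K, t, ht, hK⟩ := hC11.2 (hQ0 (u θ))
  have hQuc : Tendsto (fun x => Q (u x)) (𝓝 θ) (𝓝[{0}ᶜ] (Q (u θ))) :=
    tendsto_nhdsWithin_iff.2 ⟨(hQc.tendsto _).comp huc, Eventually.of_forall fun x => hQ0 _⟩
  refine ⟨K, ?_⟩
  filter_upwards [hQuc ht] with x hx
  have hL := hK.dist_le_mul _ hx _ (mem_of_mem_nhdsWithin (hQ0 _) ht)
  rw [dist_eq_norm, dist_eq_norm] at hL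
  have hnorm : ‖Q (u x) - Q (u θ)‖ = ‖velocity N Q x - velocity N Q θ‖ := by
    simp only [velocity, ← hu, Prod.norm_def, Prod.fst_sub, Prod.snd_sub]
    rw [max_comm, ← neg_sub', norm_neg]
  rw [← hnorm]
  refine le_trans ?_ hL
  set T := fderiv ℝ (fun v : ℝ × ℝ => N v) (Q (u x)) - fderiv ℝ (fun v : ℝ × ℝ => N v) (Q (u θ))
    with hT
  have hTv : ∀ v, T v = dot (trigPoint (polarSet (unitBall N)) x) v -
      dot (trigPoint (polarSet (unitBall N)) θ) v := fun v => by
    rw [hT, _root_.sub_apply, hQ.fderiv_apply hN hC11.1, hQ.fderiv_apply hN hC11.1,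
      htrig, htrig]
  have e1 := T.le_opNorm (1, 0)
  have e2 := T.le_opNorm (0, 1)
  rw [hTv] at e1 e2
  simp only [dot, mul_one, mul_zero, add_zero, zero_add, Prod.norm_mk, norm_one, norm_zero,
    max_eq_left zero_le_one, max_eq_right zero_le_one] at e1 e2
  exact max_le e1 e2

/-- Almost everywhere the curve of `Ω°` has a nonzero affine curvature. -/
lemma ae_exists_hasAffineCurvature (hQ : IsSupportMap N Q)
    (hN : ∀ v : ℝ × ℝ, N v = 0 → v = 0) (hC11 : IsC11Norm N) (hQc : Continuous Q) :
    ∀ᵐ θ ∂(volume.restrict (Ioo (0 : ℝ) (2 * area (polarSet (unitBall N))))),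
      ∃ k, k ≠ 0 ∧
        HasAffineCurvature (trigPoint (polarSet (unitBall N))) (velocity N Q) θ k := by
  filter_upwards [ae_differentiableAt_velocity hQ hN hQc, ae_restrict_mem measurableSet_Ioo]
    with θ hd hθ
  have hP := hasDerivAt_trigPoint hQ hN hQc hθ
  have hone := cross_trigPoint_velocity hQ hN
  obtain ⟨L, hL⟩ := exists_norm_trigPoint_sub_le hQ hN hC11 hQc hθ
  set P := trigPoint (polarSet (unitBall N)) with hPdef
  set V := velocity N Q with hV
  have hW := hd.hasDerivAt
  set W := deriv V θ with hWdef
  -- differentiating `[P, V] = 1` shows that the derivative of the velocity is parallel to `P`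
  have hPW : cross (P θ) W = 0 := by
    have h1 : HasDerivAt (fun x => (P x).1) (V θ).1 θ := hP.fst
    have h2 : HasDerivAt (fun x => (P x).2) (V θ).2 θ := hP.snd
    have h3 : HasDerivAt (fun x => (V x).1) W.1 θ := hW.fst
    have h4 : HasDerivAt (fun x => (V x).2) W.2 θ := hW.snd
    have h5 : HasDerivAt (fun x => cross (P x) (V x)) _ θ := (h1.mul h4).sub (h2.mul h3)
    have h6 : HasDerivAt (fun x => cross (P x) (V x)) 0 θ :=
      (hasDerivAt_const θ (1 : ℝ)).congr_of_eventuallyEq (Eventually.of_forall hone)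
    have := h5.unique h6
    simp only [cross]
    linarith
  have hWk : W = -(-cross W (V θ)) • P θ := by
    have h := hone θ
    simp only [cross] at h hPW
    ext
    · simp only [cross, Prod.smul_fst, smul_eq_mul]
      linear_combination (-W.1) * h + (V θ).1 * hPW
    · simp only [cross, Prod.smul_snd, smul_eq_mul]
      linear_combination (-W.2) * h + (V θ).2 * hPW
  refine ⟨-cross W (V θ), fun hk => ?_, ?_, Eventually.of_forall hone, ?_⟩
  · -- if `k = 0` then `V`, and hence `P`, has zero derivative at `θ`
    rw [hk, neg_zero, zero_smul] at hWk
    rw [hWk, hasDerivAt_iff_isLittleO] at hW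
    simp only [smul_zero, sub_zero] at hW
    have hPo : HasDerivAt P 0 θ := by
      rw [hasDerivAt_iff_isLittleO]
      simp only [smul_zero, sub_zero]
      exact (Asymptotics.IsBigO.of_bound L hL).trans_isLittleO hW
    have hV0 := hP.unique hPo
    have := hone θ
    simp [hV0, cross] at this
  · filter_upwards [isOpen_Ioo.mem_nhds hθ] with x hx using hasDerivAt_trigPoint hQ hN hQc hx
  · rwa [← hWk]

end SubFinslerHeisenberg

theorem mainTheorem8 (N : Seminorm ℝ (ℝ × ℝ)) (hN : ∀ v : ℝ × ℝ, N v = 0 → v = 0)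
    (hconv : SubFinslerHeisenberg.IsStrictlyConvexNorm N)
    (hC11 : SubFinslerHeisenberg.IsC11Norm N) :
    ∃ K : ℝ, 0 < K ∧ ∃ ε₀ : ℝ, 0 < ε₀ ∧ ∀ ε : ℝ, 0 < ε → ε < ε₀ →
      ∀ᵐ φ ∂(volume.restrict (Ico (0 : ℝ) (2 * SubFinslerHeisenberg.area
          (SubFinslerHeisenberg.polarSet (SubFinslerHeisenberg.unitBall N))))),
        ∀ r : ℝ, 0 < r → ∀ ω : ℝ, ω ≠ 0 →
          ∃ C : ℝ, 0 < C ∧ ∃ ρ : ℝ, 0 < ρ ∧ ∀ t ∈ Icc (-ρ) ρ,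
            DifferentiableAt ℝ
              (fun p : ℝ × ℝ × ℝ => SubFinslerHeisenberg.expMap N p.1 p.2.1 p.2.2 t) (φ, ω, r) ∧
            C * (1 - K * ε) * |t| ^ 5 ≤ SubFinslerHeisenberg.jacobian N φ ω r t ∧
            SubFinslerHeisenberg.jacobian N φ ω r t ≤ C * (1 + K * ε) * |t| ^ 5 ∧
            (t ≠ 0 →
              C * (1 - K * ε) * |t| ^ 5 < SubFinslerHeisenberg.jacobian N φ ω r t ∧
              SubFinslerHeisenberg.jacobian N φ ω r t < C * (1 + K * ε) * |t| ^ 5) := by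
  -- the Jacobian is asymptotic to `C |t| ^ 5`, so any constants `K ≥ 1` and `ε₀ ≤ 1` will do
  obtain ⟨Q, hQ⟩ := SubFinslerHeisenberg.exists_isSupportMap hN
  have hQc := hQ.continuous hN hconv
  refine ⟨1, one_pos, 1, one_pos, fun ε hε hε1 => ?_⟩
  rw [← Measure.restrict_congr_set Ioo_ae_eq_Ico]
  filter_upwards [SubFinslerHeisenberg.ae_exists_hasAffineCurvature hQ hN hC11 hQc] with φ hφ
  obtain ⟨k, hk, H⟩ := hφ
  intro r hr ω hω
  simp only [one_mul]
  exact H.jacobian_bounds N hk hε hε1 hr hω
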